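/- For $1<p<\infty$ let $H^p$ be the Hardy space of holomorphic functions $f$ on the unit disk $\mathbb{D}$ with $\|f\|_p := \Big(\sup_{0\le r<1}\frac{1}{2\pi}\int_0^{2\pi}|f(re^{i\theta})|^p\,d\theta\Big)^{1/p}<\infty$. For $f\in H^p$ and an integer $n\ge 0$, let $q_{n,p}[f]$, the $n$-th optimal polynomial approximant to $1/f$ in $H^p$, be the polynomial $q$ that minimizes $\|1-qf\|_p$ among all complex polynomials of degree at most $n$. A function $f$ is inner if it is bounded and holomorphic on $\mathbb{D}$ and its radial limits satisfy $|\lim_{r\to1^-}f(re^{i\theta})|=1$ for almost every $\theta$. **Theorem.** For every $1<p<\infty$ there is a constant $\rho>0$, depending only on $p$, such that the following holds: if $f\in H^p$ is an inner function with $f(0)\neq 0$, and $q_{1,p}[f](z)=a(z-w)$ for some $a,w\in\mathbb{C}$, then $|w|\ge\rho$. -/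

import Mathlib

open MeasureTheory Filter Topology

namespace HardyOPA

/-- The integral mean `(1 / 2π) ∫₀^{2π} |f (r e^{iθ})| ^ p dθ`. -/
noncomputable def integralMean (p : ℝ) (f : ℂ → ℂ) (r : ℝ) : ℝ :=
  (2 * Real.pi)⁻¹ * ∫ θ in (0 : ℝ)..(2 * Real.pi), ‖f (circleMap 0 r θ)‖ ^ p

/-- Membership in the Hardy space `H^p` of the unit disk. Only the values of `f` on the open
unit disk matter. -/
def MemHardy (p : ℝ) (f : ℂ → ℂ) : Prop :=
  DifferentiableOn ℂ f (Metric.ball 0 1) ∧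
    BddAbove (Set.range fun r : Set.Ico (0 : ℝ) 1 => integralMean p f r)

/-- The `H^p` norm; meaningful for `f` with `MemHardy p f`, where the supremum is finite. -/
noncomputable def hardyNorm (p : ℝ) (f : ℂ → ℂ) : ℝ :=
  (⨆ r : Set.Ico (0 : ℝ) 1, integralMean p f r) ^ (1 / p)

/-- Inner functions: bounded holomorphic functions on the unit disk whose radial limits exist and
are unimodular at almost every boundary point. -/
def IsInner (f : ℂ → ℂ) : Prop :=
  DifferentiableOn ℂ f (Metric.ball 0 1) ∧
    (∃ M : ℝ, ∀ z ∈ Metric.ball (0 : ℂ) 1, ‖f z‖ ≤ M) ∧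
    ∀ᵐ θ : ℝ, ∃ ζ : ℂ, ‖ζ‖ = 1 ∧
      Tendsto (fun r : ℝ => f (circleMap 0 r θ)) (𝓝[<] 1) (𝓝 ζ)

/-- `q` is the `n`-th optimal polynomial approximant to `1 / f` in `H^p`: it minimizes
`‖1 - q f‖_p` among the complex polynomials of degree at most `n`. -/
def IsOPA (n : ℕ) (p : ℝ) (f : ℂ → ℂ) (q : Polynomial ℂ) : Prop :=
  q.natDegree ≤ n ∧ ∀ s : Polynomial ℂ, s.natDegree ≤ n →
    hardyNorm p (fun z => 1 - q.eval z * f z) ≤ hardyNorm p (fun z => 1 - s.eval z * f z)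

end HardyOPA

namespace HardyOPA

/-! For `g` holomorphic and uniformly small, integrating the expansion of `‖1 + g‖ ^ p` over a
circle leaves `1 + (taylorPart p (g 0)).re + (p / 2) ^ 2 * (mean of ‖g‖ ^ 2)` up to a cubic error,
because the remaining quadratic term is the real part of a holomorphic function. Let `q = a(z - w)`
be optimal with `w` close to `0`. If `‖a‖` is small, the constant `-aw` is a better competitor: it
has the same value at `0`, so the `taylorPart` terms cancel, while the mean square of `qf` is about
`‖a‖ ^ 2` (`mean_sq_linear_mul_ge`) and that of `awf` at most `‖a w‖ ^ 2`. If `‖a‖` is large,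
convexity lets `q` be shrunk to leading coefficient of size `d` while the mean stays at most `1`,
the value for the zero polynomial. The expansion then makes this mean exceed `1`, since its linear
term is `O(‖w‖)`. Innerness enters through `‖f‖ ≤ 1` and the mean of `‖f‖ ^ 2` tending to `1`; `f 0
≠ 0` gives `a ≠ 0`. -/

/-! ### Pointwise expansion of `‖1 + z‖ ^ p`. -/

/-- Second order Taylor expansion of `x ↦ (1 + x) ^ s` at the origin. -/
lemma one_add_rpow_taylor (s : ℝ) :
    (fun x : ℝ => (1 + x) ^ s - (1 + s * x + s * (s - 1) / 2 * x ^ 2)) =O[𝓝 0]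
      fun x => ‖x‖ ^ 3 := by
  have h := (Real.one_add_rpow_hasFPowerSeriesAt_zero (a := s)).isBigO_sub_partialSum_pow 3
  refine h.congr_left fun x => ?_
  have h2 : Ring.choose s 2 = s * (s - 1) / 2 := by
    have := Ring.descPochhammer_eq_factorial_smul_choose s 2
    simp [descPochhammer_succ_right, Polynomial.smeval_mul, Polynomial.smeval_sub] at this
    linarith
  simp [FormalMultilinearSeries.partialSum, Finset.sum_range_succ, binomialSeries, h2]
  ring

lemma norm_one_add_sq (z : ℂ) : ‖1 + z‖ ^ 2 = 1 + (2 * z.re + ‖z‖ ^ 2) := by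
  rw [Complex.sq_norm, Complex.sq_norm, Complex.normSq_apply, Complex.normSq_apply]
  simp
  ring

/-- The real part of this holomorphic quadratic polynomial, together with `(p / 2) ^ 2 * ‖z‖ ^ 2`,
forms the second order Taylor polynomial of `‖1 + z‖ ^ p - 1`. -/
noncomputable def taylorPart (p : ℝ) (z : ℂ) : ℂ :=
  p * z + ((p / 2 * (p / 2 - 1) : ℝ) : ℂ) * z ^ 2

/-- Apply the one-variable expansion with exponent `p / 2` to `‖1 + z‖ ^ 2 = 1 + x`, then split `2 *
z.re ^ 2 = (z ^ 2).re + ‖z‖ ^ 2`. -/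
lemma norm_one_add_rpow_taylor (p : ℝ) :
    ∃ δ > 0, ∃ K > 0, ∀ z : ℂ, ‖z‖ ≤ δ →
      |‖1 + z‖ ^ p - (1 + (taylorPart p z).re + (p / 2) ^ 2 * ‖z‖ ^ 2)| ≤ K * ‖z‖ ^ 3 := by
  obtain ⟨C, hC0, hC⟩ := (one_add_rpow_taylor (p / 2)).exists_pos
  rw [Asymptotics.isBigOWith_iff, Metric.eventually_nhds_iff] at hC
  obtain ⟨ε, hε, hC⟩ := hC
  set c := p / 2 * (p / 2 - 1) / 2 with hc
  -- `27` comes from `|x| ≤ 3 * ‖z‖`, and `5` from the terms of order at least three in `x ^ 2`.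
  refine ⟨min 1 (ε / 4), by positivity, 27 * C + 5 * |c|, by positivity, fun z hz => ?_⟩
  have hz1 : ‖z‖ ≤ 1 := hz.trans (min_le_left _ _)
  have hz2 : ‖z‖ ≤ ε / 4 := hz.trans (min_le_right _ _)
  have hre := Complex.abs_re_le_norm z
  set x : ℝ := 2 * z.re + ‖z‖ ^ 2 with hx
  have hxz : |x| ≤ 3 * ‖z‖ := by
    calc |x| ≤ |2 * z.re| + |‖z‖ ^ 2| := abs_add_le _ _
      _ = 2 * |z.re| + ‖z‖ ^ 2 := by rw [abs_mul, abs_two, abs_of_nonneg (sq_nonneg ‖z‖)]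
      _ ≤ 3 * ‖z‖ := by nlinarith [norm_nonneg z]
  have hlt : dist x 0 < ε := by
    rw [Real.dist_eq, sub_zero]; linarith
  have h1 := hC hlt
  have hpow : ‖1 + z‖ ^ p = (1 + x) ^ (p / 2) := by
    rw [hx, ← norm_one_add_sq, ← Real.rpow_natCast_mul (norm_nonneg _)]
    congr 1
    push_cast; ring
  have hsq : (z ^ 2).re = 2 * z.re ^ 2 - ‖z‖ ^ 2 := by
    rw [Complex.sq_norm, Complex.normSq_apply, pow_two]; simp; ring
  have hre2 : (taylorPart p z).re = p * z.re + 2 * c * (2 * z.re ^ 2 - ‖z‖ ^ 2) := by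
    rw [taylorPart, Complex.add_re, Complex.re_ofReal_mul, Complex.re_ofReal_mul, hsq, hc]
    ring
  have h2 : ‖1 + z‖ ^ p - (1 + (taylorPart p z).re + (p / 2) ^ 2 * ‖z‖ ^ 2) =
      ((1 + x) ^ (p / 2) - (1 + p / 2 * x + p / 2 * (p / 2 - 1) / 2 * x ^ 2))
        + c * (4 * z.re * ‖z‖ ^ 2 + ‖z‖ ^ 4) := by
    rw [hpow, hre2, hx, hc]; ring
  rw [h2]
  have h3 : |4 * z.re * ‖z‖ ^ 2 + ‖z‖ ^ 4| ≤ 5 * ‖z‖ ^ 3 := by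
    have e1 : |4 * z.re * ‖z‖ ^ 2| = 4 * |z.re| * ‖z‖ ^ 2 := by
      rw [abs_mul, abs_mul, abs_of_nonneg (sq_nonneg ‖z‖)]; norm_num
    have e2 : |‖z‖ ^ 4| = ‖z‖ ^ 4 := abs_of_nonneg (by positivity)
    have e3 : ‖z‖ ^ 4 ≤ ‖z‖ ^ 3 := pow_le_pow_of_le_one (norm_nonneg _) hz1 (by norm_num)
    have e4 : |z.re| * ‖z‖ ^ 2 ≤ ‖z‖ * ‖z‖ ^ 2 := by gcongr
    refine (abs_add_le _ _).trans ?_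
    rw [e1, e2]
    nlinarith
  have h4 : ‖(1 + x) ^ (p / 2) - (1 + p / 2 * x + p / 2 * (p / 2 - 1) / 2 * x ^ 2)‖
      ≤ C * (3 * ‖z‖) ^ 3 := by
    refine h1.trans ?_
    rw [norm_pow, norm_norm, Real.norm_eq_abs]
    gcongr
  rw [Real.norm_eq_abs] at h4
  refine (abs_add_le _ _).trans ?_
  rw [abs_mul c]
  have h5 := mul_le_mul_of_nonneg_left h3 (abs_nonneg c)
  linarith

/-! ### Circle averages and the expansion of integral means. -/

lemma diffContOnCl_ball {g : ℂ → ℂ} (hg : DifferentiableOn ℂ g (Metric.ball 0 1)) {r : ℝ}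
    (h0 : 0 ≤ r) (h1 : r < 1) : DiffContOnCl ℂ g (Metric.ball 0 |r|) := by
  rw [abs_of_nonneg h0]
  exact DifferentiableOn.diffContOnCl
    (hg.mono (Metric.closure_ball_subset_closedBall.trans (Metric.closedBall_subset_ball h1)))

lemma sphere_subset_unitBall {r : ℝ} (h0 : 0 ≤ r) (h1 : r < 1) :
    Metric.sphere (0 : ℂ) |r| ⊆ Metric.ball 0 1 := by
  rw [abs_of_nonneg h0]
  exact Metric.sphere_subset_closedBall.trans (Metric.closedBall_subset_ball h1)

lemma circleIntegrable_of_continuousOn {E : Type*} [NormedAddCommGroup E] {g : ℂ → E}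
    (hg : ContinuousOn g (Metric.ball 0 1)) {r : ℝ} (h0 : 0 ≤ r) (h1 : r < 1) :
    CircleIntegrable g 0 r :=
  (hg.mono (sphere_subset_unitBall h0 h1)).circleIntegrable'

lemma circleAverage_re {g : ℂ → ℂ} (hg : DifferentiableOn ℂ g (Metric.ball 0 1)) {r : ℝ}
    (h0 : 0 ≤ r) (h1 : r < 1) : Real.circleAverage (fun z => (g z).re) 0 r = (g 0).re := by
  have h := Complex.reCLM.circleAverage_comp_comm
    (circleIntegrable_of_continuousOn hg.continuousOn h0 h1)
  rw [(diffContOnCl_ball hg h0 h1).circleAverage] at h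
  exact h

lemma integralMean_eq_circleAverage (p : ℝ) (f : ℂ → ℂ) (r : ℝ) :
    integralMean p f r = Real.circleAverage (fun z => ‖f z‖ ^ p) 0 r := rfl

lemma continuousOn_norm_rpow {p : ℝ} (hp : 0 ≤ p) {g : ℂ → ℂ} {S : Set ℂ}
    (hg : ContinuousOn g S) : ContinuousOn (fun z => ‖g z‖ ^ p) S :=
  hg.norm.rpow_const fun _ _ => Or.inr hp

lemma differentiableOn_taylorPart {p : ℝ} {g : ℂ → ℂ} {S : Set ℂ} (hg : DifferentiableOn ℂ g S) :
    DifferentiableOn ℂ (fun z => taylorPart p (g z)) S := by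
  unfold taylorPart
  fun_prop

/-- `K` bounds the error of the second order expansion of `‖1 + z‖ ^ p` on the disk of
radius `δ`. -/
def TaylorBound (p δ K : ℝ) : Prop :=
  ∀ z : ℂ, ‖z‖ ≤ δ →
    |‖1 + z‖ ^ p - (1 + (taylorPart p z).re + (p / 2) ^ 2 * ‖z‖ ^ 2)| ≤ K * ‖z‖ ^ 3

/-- The mean value property evaluates the average of the holomorphic part at `0`. -/
lemma integralMean_one_add_le {p δ K η r : ℝ} {g : ℂ → ℂ} (hT : TaylorBound p δ K) (hp : 0 ≤ p)
    (hK : 0 ≤ K) (hg : DifferentiableOn ℂ g (Metric.ball 0 1))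
    (hη : ∀ z ∈ Metric.ball (0 : ℂ) 1, ‖g z‖ ≤ η) (hηδ : η ≤ δ) (h0 : 0 ≤ r) (h1 : r < 1) :
    integralMean p (fun z => 1 + g z) r ≤
      1 + (taylorPart p (g 0)).re + (p / 2) ^ 2 * η ^ 2 + K * η ^ 3 := by
  have hh := differentiableOn_taylorPart (p := p) hg
  have hre : ContinuousOn (fun z => (taylorPart p (g z)).re) (Metric.ball 0 1) :=
    Complex.continuous_re.comp_continuousOn hh.continuousOn
  rw [integralMean_eq_circleAverage]
  calc Real.circleAverage (fun z => ‖1 + g z‖ ^ p) 0 r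
      ≤ Real.circleAverage
          (fun z => (taylorPart p (g z)).re + (1 + (p / 2) ^ 2 * η ^ 2 + K * η ^ 3)) 0 r := by
        refine Real.circleAverage_mono (circleIntegrable_of_continuousOn
          (continuousOn_norm_rpow hp (continuousOn_const.add hg.continuousOn)) h0 h1)
          (circleIntegrable_of_continuousOn (hre.add continuousOn_const) h0 h1) fun z hz => ?_
        have hz' := hη z (sphere_subset_unitBall h0 h1 hz)
        have ht := (abs_le.1 (hT (g z) (hz'.trans hηδ))).2
        have e2 : (p / 2) ^ 2 * ‖g z‖ ^ 2 ≤ (p / 2) ^ 2 * η ^ 2 := by gcongr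
        have e3 : K * ‖g z‖ ^ 3 ≤ K * η ^ 3 := by gcongr
        linarith
    _ = _ := by
        rw [Real.circleAverage_fun_add (circleIntegrable_of_continuousOn hre h0 h1)
          (circleIntegrable_const _ _ _), circleAverage_re hh h0 h1, Real.circleAverage_const]
        ring

lemma le_integralMean_one_add {p δ K η r : ℝ} {g : ℂ → ℂ} (hT : TaylorBound p δ K) (hp : 0 ≤ p)
    (hK : 0 ≤ K) (hg : DifferentiableOn ℂ g (Metric.ball 0 1))
    (hη : ∀ z ∈ Metric.ball (0 : ℂ) 1, ‖g z‖ ≤ η) (hηδ : η ≤ δ) (h0 : 0 ≤ r) (h1 : r < 1) :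
    1 + (taylorPart p (g 0)).re + (p / 2) ^ 2 * Real.circleAverage (fun z => ‖g z‖ ^ 2) 0 r
      - K * η ^ 3 ≤ integralMean p (fun z => 1 + g z) r := by
  have hh := differentiableOn_taylorPart (p := p) hg
  have hre : ContinuousOn (fun z => (taylorPart p (g z)).re) (Metric.ball 0 1) :=
    Complex.continuous_re.comp_continuousOn hh.continuousOn
  have hsq : ContinuousOn (fun z => (p / 2) ^ 2 * ‖g z‖ ^ 2) (Metric.ball 0 1) :=
    continuousOn_const.mul (hg.continuousOn.norm.pow 2)
  have hi1 := circleIntegrable_of_continuousOn hre h0 h1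
  have hi2 := circleIntegrable_of_continuousOn hsq h0 h1
  have hi3 := circleIntegrable_const (1 - K * η ^ 3) (0 : ℂ) r
  have hi23 : CircleIntegrable (fun z => (p / 2) ^ 2 * ‖g z‖ ^ 2 + (1 - K * η ^ 3)) 0 r :=
    hi2.add hi3
  rw [integralMean_eq_circleAverage]
  calc _ = Real.circleAverage (fun z => (taylorPart p (g z)).re +
          ((p / 2) ^ 2 * ‖g z‖ ^ 2 + (1 - K * η ^ 3))) 0 r := by
        rw [Real.circleAverage_fun_add hi1 hi23, Real.circleAverage_fun_add hi2 hi3,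
          circleAverage_re hh h0 h1, Real.circleAverage_const]
        have := Real.circleAverage_fun_smul (a := (p / 2) ^ 2) (f := fun z => ‖g z‖ ^ 2)
          (c := 0) (R := r)
        simp only [smul_eq_mul] at this
        rw [this]
        ring
    _ ≤ Real.circleAverage (fun z => ‖1 + g z‖ ^ p) 0 r := by
        refine Real.circleAverage_mono (hi1.add hi23) (circleIntegrable_of_continuousOn
          (continuousOn_norm_rpow hp (continuousOn_const.add hg.continuousOn)) h0 h1)
          fun z hz => ?_
        have hz' := hη z (sphere_subset_unitBall h0 h1 hz)
        have ht := (abs_le.1 (hT (g z) (hz'.trans hηδ))).1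
        have e3 : K * ‖g z‖ ^ 3 ≤ K * η ^ 3 := by gcongr
        linarith

/-! ### Inner functions: sup bound and mean squares. -/

lemma IsInner.tendsto_circleAverage {f : ℂ → ℂ} (hf : IsInner f) (n : ℕ) :
    Tendsto (fun r => Real.circleAverage (fun z => ‖f z‖ ^ n) 0 r) (𝓝[<] 1) (𝓝 1) := by
  obtain ⟨hd, ⟨M, hM⟩, hlim⟩ := hf
  have hIoo : ∀ᶠ r : ℝ in 𝓝[<] 1, r ∈ Set.Ioo (0 : ℝ) 1 := Ioo_mem_nhdsLT one_pos
  have hmem : ∀ r ∈ Set.Ioo (0 : ℝ) 1, ∀ θ, circleMap 0 r θ ∈ Metric.ball (0 : ℂ) 1 := by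
    intro r hr θ
    simpa [abs_of_pos hr.1] using hr.2
  have hint : Tendsto (fun r : ℝ => ∫ θ in (0 : ℝ)..(2 * Real.pi), ‖f (circleMap 0 r θ)‖ ^ n)
      (𝓝[<] 1) (𝓝 (∫ _ in (0 : ℝ)..(2 * Real.pi), (1 : ℝ))) := by
    refine intervalIntegral.tendsto_integral_filter_of_dominated_convergence (fun _ => M ^ n)
      ?_ ?_ intervalIntegrable_const ?_
    · filter_upwards [hIoo] with r hr
      refine Continuous.aestronglyMeasurable ?_
      exact (hd.continuousOn.comp_continuous (continuous_circleMap 0 r) (hmem r hr)).norm.pow n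
    · filter_upwards [hIoo] with r hr
      refine Eventually.of_forall fun θ _ => ?_
      rw [norm_pow, norm_norm]
      gcongr
      exact hM _ (hmem r hr θ)
    · filter_upwards [hlim] with θ hθ _
      obtain ⟨ζ, hζ, ht⟩ := hθ
      simpa [hζ] using ht.norm.pow n
  have h := hint.const_mul (2 * Real.pi)⁻¹
  have h1 : (2 * Real.pi)⁻¹ * ∫ _ in (0 : ℝ)..(2 * Real.pi), (1 : ℝ) = 1 := by
    rw [intervalIntegral.integral_const, smul_eq_mul, mul_one, sub_zero,
      inv_mul_cancel₀ Real.two_pi_pos.ne']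
  rwa [h1] at h

/-- Cauchy's formula for `f ^ n`. The factor `(r - ‖w‖)⁻¹` does not depend on `n`, so large powers
can be used to remove it. -/
lemma norm_pow_le_circleAverage {f : ℂ → ℂ} (hf : DifferentiableOn ℂ f (Metric.ball 0 1)) (n : ℕ)
    {r : ℝ} (h1 : r < 1) {w : ℂ} (hw : ‖w‖ < r) :
    ‖f w‖ ^ n ≤ (r - ‖w‖)⁻¹ * Real.circleAverage (fun z => ‖f z‖ ^ n) 0 r := by
  have h0 : 0 ≤ r := (norm_nonneg w).trans hw.le
  have hpos : 0 < r - ‖w‖ := sub_pos.2 hw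
  have hsphere : ∀ z ∈ Metric.sphere (0 : ℂ) |r|, r - ‖w‖ ≤ ‖z - w‖ := by
    intro z hz
    have : ‖z‖ = r := by simpa [abs_of_nonneg h0] using hz
    simpa [this] using norm_sub_norm_le z w
  have hmem : ∀ θ, circleMap 0 r θ ∈ Metric.sphere (0 : ℂ) |r| := circleMap_mem_sphere' 0 r
  have hc := circleIntegrable_of_continuousOn (hf.continuousOn.norm.pow n) h0 h1
  have hrep := (diffContOnCl_ball (hf.pow n) h0 h1).circleAverage_smul_div
    (w := w) (by simpa [abs_of_nonneg h0] using hw)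
  have hsm : (fun z => (r - ‖w‖)⁻¹ * ‖f z‖ ^ n) = fun z => (r - ‖w‖)⁻¹ • ‖f z‖ ^ n := rfl
  calc ‖f w‖ ^ n = ‖(f ^ n) w‖ := by simp
    _ ≤ Real.circleAverage (fun z => (r - ‖w‖)⁻¹ * ‖f z‖ ^ n) 0 r := by
        rw [← hrep, Real.circleAverage, Real.circleAverage, norm_smul, smul_eq_mul,
          Real.norm_of_nonneg (by positivity)]
        gcongr
        refine intervalIntegral.norm_integral_le_of_norm_le Real.two_pi_pos.le
          (Eventually.of_forall fun θ _ => ?_) ?_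
        · rw [norm_smul, norm_div, sub_zero, Pi.pow_apply, norm_pow]
          gcongr
          rw [div_le_iff₀ (hpos.trans_le (hsphere _ (hmem θ)))]
          have hz : ‖circleMap 0 r θ‖ ≤ 1 := by simpa [abs_of_nonneg h0] using h1.le
          refine hz.trans ?_
          rw [inv_mul_eq_div, one_le_div hpos]
          exact hsphere _ (hmem θ)
        · exact hc.const_mul _
    _ = _ := by rw [hsm, Real.circleAverage_fun_smul, smul_eq_mul]

lemma IsInner.norm_le_one {f : ℂ → ℂ} (hf : IsInner f) {w : ℂ}
    (hw : w ∈ Metric.ball (0 : ℂ) 1) : ‖f w‖ ≤ 1 := by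
  have hw' : ‖w‖ < 1 := by simpa using hw
  by_contra! hlt
  -- Power trick: `‖f w‖ ^ n` stays below `(1 - ‖w‖)⁻¹` for every `n`, which is impossible if `‖f w‖
  -- > 1`.
  obtain ⟨n, hn⟩ := pow_unbounded_of_one_lt ((1 - ‖w‖)⁻¹) hlt
  refine hn.not_ge ?_
  have hlim : Tendsto (fun r => (r - ‖w‖)⁻¹ * Real.circleAverage (fun z => ‖f z‖ ^ n) 0 r)
      (𝓝[<] 1) (𝓝 ((1 - ‖w‖)⁻¹ * 1)) := by
    refine Tendsto.mul (Tendsto.inv₀ ?_ (sub_pos.2 hw').ne') (hf.tendsto_circleAverage n)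
    exact (tendsto_id.sub_const _).mono_left nhdsWithin_le_nhds
  rw [mul_one] at hlim
  refine ge_of_tendsto hlim ?_
  filter_upwards [Ioo_mem_nhdsLT hw'] with r hr
  exact norm_pow_le_circleAverage hf.1 n hr.2 hr.1

lemma IsInner.exists_half_le_mean_sq {f : ℂ → ℂ} (hf : IsInner f) :
    ∃ r ∈ Set.Ico (0 : ℝ) 1,
      1 / 2 ≤ r ^ 2 * Real.circleAverage (fun z => ‖f z‖ ^ 2) 0 r := by
  have hlim : Tendsto (fun r : ℝ => r ^ 2 * Real.circleAverage (fun z => ‖f z‖ ^ 2) 0 r)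
      (𝓝[<] 1) (𝓝 (1 ^ 2 * 1)) :=
    ((tendsto_id.pow 2).mono_left nhdsWithin_le_nhds).mul (hf.tendsto_circleAverage 2)
  have hev := hlim.eventually_const_le (show (1 / 2 : ℝ) < 1 ^ 2 * 1 by norm_num)
  obtain ⟨r, hr, hr'⟩ := (hev.and (Ico_mem_nhdsLT one_pos)).exists
  exact ⟨r, hr', hr⟩

/-- On the circle, `‖z - w‖ ^ 2 ≥ (r - ‖w‖) ^ 2`, and `‖f‖ ≤ 1` bounds the cross term by `2 * ‖w‖`.
-/
lemma mean_sq_linear_mul_ge {f : ℂ → ℂ} (hf : DifferentiableOn ℂ f (Metric.ball 0 1))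
    (hf1 : ∀ z ∈ Metric.ball (0 : ℂ) 1, ‖f z‖ ≤ 1) {r : ℝ} (h0 : 0 ≤ r) (h1 : r < 1)
    (hr : 1 / 2 ≤ r ^ 2 * Real.circleAverage (fun z => ‖f z‖ ^ 2) 0 r) (a w : ℂ) :
    ‖a‖ ^ 2 * (1 / 2 - 2 * ‖w‖) ≤
      Real.circleAverage (fun z => ‖-(a * (z - w) * f z)‖ ^ 2) 0 r := by
  have hc : ContinuousOn (fun z => (‖a‖ ^ 2 * r ^ 2) • ‖f z‖ ^ 2) (Metric.ball 0 1) := by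
    have := hf.continuousOn
    fun_prop
  have hi := circleIntegrable_of_continuousOn hc h0 h1
  have hi2 := circleIntegrable_const (-(2 * ‖a‖ ^ 2 * ‖w‖)) (0 : ℂ) r
  have hg : ContinuousOn (fun z => ‖-(a * (z - w) * f z)‖ ^ 2) (Metric.ball 0 1) := by
    have := hf.continuousOn
    fun_prop
  calc ‖a‖ ^ 2 * (1 / 2 - 2 * ‖w‖)
      ≤ ‖a‖ ^ 2 * (r ^ 2 * Real.circleAverage (fun z => ‖f z‖ ^ 2) 0 r - 2 * ‖w‖) := by gcongr
    _ = Real.circleAverage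
          (fun z => (‖a‖ ^ 2 * r ^ 2) • ‖f z‖ ^ 2 + -(2 * ‖a‖ ^ 2 * ‖w‖)) 0 r := by
        rw [Real.circleAverage_fun_add hi hi2, Real.circleAverage_fun_smul,
          Real.circleAverage_const, smul_eq_mul]
        ring
    _ ≤ _ := by
        refine Real.circleAverage_mono (hi.add hi2)
          (circleIntegrable_of_continuousOn hg h0 h1) fun z hz => ?_
        have hzr : ‖z‖ = r := by simpa [abs_of_nonneg h0] using hz
        have hfz := hf1 z (sphere_subset_unitBall h0 h1 hz)
        have hd : |r - ‖w‖| ≤ ‖z - w‖ := hzr ▸ abs_norm_sub_norm_le z w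
        have hd2 : (r - ‖w‖) ^ 2 ≤ ‖z - w‖ ^ 2 := sq_le_sq.2 (by rwa [abs_norm])
        have hd3 : (r - ‖w‖) ^ 2 * ‖f z‖ ^ 2 ≤ ‖z - w‖ ^ 2 * ‖f z‖ ^ 2 := by gcongr
        have hd4 : r * ‖w‖ * ‖f z‖ ^ 2 ≤ 1 * ‖w‖ * 1 ^ 2 := by gcongr
        have hd5 : 0 ≤ ‖w‖ ^ 2 * ‖f z‖ ^ 2 := by positivity
        have key : r ^ 2 * ‖f z‖ ^ 2 - 2 * ‖w‖ ≤ ‖z - w‖ ^ 2 * ‖f z‖ ^ 2 := by nlinarith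
        rw [norm_neg, norm_mul, norm_mul, mul_pow, mul_pow, smul_eq_mul]
        nlinarith [mul_le_mul_of_nonneg_left key (sq_nonneg ‖a‖)]

/-! ### Consequences of optimality. -/

lemma integralMean_nonneg (p : ℝ) (f : ℂ → ℂ) (r : ℝ) : 0 ≤ integralMean p f r :=
  Real.circleAverage_nonneg_of_nonneg (f := fun z => ‖f z‖ ^ p) fun _ _ => by positivity

lemma bddAbove_integralMean_of_bounded {p M : ℝ} (hp : 0 ≤ p) {g : ℂ → ℂ}
    (hg : ContinuousOn g (Metric.ball 0 1)) (hM : ∀ z ∈ Metric.ball (0 : ℂ) 1, ‖g z‖ ≤ M) :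
    BddAbove (Set.range fun r : Set.Ico (0 : ℝ) 1 => integralMean p g r) := by
  refine ⟨M ^ p, ?_⟩
  rintro _ ⟨⟨r, h0, h1⟩, rfl⟩
  refine Real.circleAverage_mono_on_of_le_circle
    (circleIntegrable_of_continuousOn (continuousOn_norm_rpow hp hg) h0 h1) fun z hz => ?_
  exact Real.rpow_le_rpow (norm_nonneg _) (hM z (sphere_subset_unitBall h0 h1 hz)) hp

/-- Turns minimality of norms into an estimate on a single circle, where the expansions apply. -/
lemma IsOPA.integralMean_le {n : ℕ} {p : ℝ} (hp : 0 < p) {f : ℂ → ℂ}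
    (hf : DifferentiableOn ℂ f (Metric.ball 0 1))
    (hf1 : ∀ z ∈ Metric.ball (0 : ℂ) 1, ‖f z‖ ≤ 1) {q : Polynomial ℂ} (hq : IsOPA n p f q)
    {s : Polynomial ℂ} (hs : s.natDegree ≤ n) {U : ℝ}
    (hU : ∀ r ∈ Set.Ico (0 : ℝ) 1, integralMean p (fun z => 1 - s.eval z * f z) r ≤ U)
    {r : ℝ} (hr : r ∈ Set.Ico (0 : ℝ) 1) :
    integralMean p (fun z => 1 - q.eval z * f z) r ≤ U := by
  have : Nonempty (Set.Ico (0 : ℝ) 1) := ⟨⟨r, hr⟩⟩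
  obtain ⟨B, hB⟩ := (isCompact_closedBall (0 : ℂ) 1).exists_bound_of_continuousOn
    q.continuous.continuousOn
  have hcont : ContinuousOn (fun z => 1 - q.eval z * f z) (Metric.ball 0 1) :=
    continuousOn_const.sub (q.continuous.continuousOn.mul hf.continuousOn)
  -- A real supremum dominates its terms only when the family is bounded above.
  have hbdd := bddAbove_integralMean_of_bounded hp.le hcont (M := 1 + B * 1) fun z hz => by
    refine (norm_sub_le _ _).trans ?_
    rw [norm_one, norm_mul]
    have h1 := hB z (Metric.ball_subset_closedBall hz)
    have h2 := (norm_nonneg _).trans h1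
    gcongr
    exact hf1 z hz
  have hle := hq.2 s hs
  rw [hardyNorm, hardyNorm, Real.rpow_le_rpow_iff
    (Real.iSup_nonneg fun _ => integralMean_nonneg _ _ _)
    (Real.iSup_nonneg fun _ => integralMean_nonneg _ _ _) (by positivity)] at hle
  exact (le_ciSup hbdd ⟨r, hr⟩).trans (hle.trans (ciSup_le fun x => hU x x.2))

lemma IsOPA.integralMean_le_one {n : ℕ} {p : ℝ} (hp : 0 < p) {f : ℂ → ℂ}
    (hf : DifferentiableOn ℂ f (Metric.ball 0 1))
    (hf1 : ∀ z ∈ Metric.ball (0 : ℂ) 1, ‖f z‖ ≤ 1) {q : Polynomial ℂ} (hq : IsOPA n p f q)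
    {r : ℝ} (hr : r ∈ Set.Ico (0 : ℝ) 1) :
    integralMean p (fun z => 1 - q.eval z * f z) r ≤ 1 := by
  refine hq.integralMean_le hp hf hf1 (s := 0) (by simp) (fun r _ => ?_) hr
  simp [integralMean_eq_circleAverage, Real.circleAverage_const]

/-- Convexity of `x ↦ x ^ p` along the segment from `1` to `1 - g`; this is where `1 ≤ p` is needed.
-/
lemma integralMean_one_sub_smul_le {p r t : ℝ} (hp : 1 ≤ p) {g : ℂ → ℂ}
    (hg : ContinuousOn g (Metric.ball 0 1)) (h0 : 0 ≤ r) (h1 : r < 1) (ht0 : 0 ≤ t) (ht1 : t ≤ 1)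
    (h : integralMean p (fun z => 1 - g z) r ≤ 1) :
    integralMean p (fun z => 1 - t * g z) r ≤ 1 := by
  have hp0 : 0 ≤ p := zero_le_one.trans hp
  have hi := circleIntegrable_of_continuousOn (continuousOn_norm_rpow hp0
    (continuousOn_const.sub (continuousOn_const.mul hg)) :
      ContinuousOn (fun z => ‖1 - t * g z‖ ^ p) (Metric.ball 0 1)) h0 h1
  have hi1 : CircleIntegrable (fun z => t • ‖1 - g z‖ ^ p) 0 r :=
    circleIntegrable_of_continuousOn ((continuousOn_norm_rpow hp0
      (continuousOn_const.sub hg) : ContinuousOn (fun z => ‖1 - g z‖ ^ p) _).const_smul t) h0 h1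
  have hi2 := circleIntegrable_const (1 - t) (0 : ℂ) r
  calc integralMean p (fun z => 1 - t * g z) r
      ≤ Real.circleAverage (fun z => t • ‖1 - g z‖ ^ p + (1 - t)) 0 r := by
        refine Real.circleAverage_mono hi (hi1.add hi2) fun z _ => ?_
        have hn : ‖1 - t * g z‖ ≤ t * ‖1 - g z‖ + (1 - t) * 1 := by
          have he : 1 - t * g z = t * (1 - g z) + ((1 - t : ℝ) : ℂ) := by push_cast; ring
          rw [he]
          refine (norm_add_le _ _).trans ?_
          rw [norm_mul, Complex.norm_of_nonneg ht0, Complex.norm_of_nonneg (sub_nonneg.2 ht1),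
            mul_one]
        have hc := (convexOn_rpow hp).2 (norm_nonneg (1 - g z))
          (show (1 : ℝ) ∈ Set.Ici 0 from Set.mem_Ici.2 zero_le_one) ht0
          (sub_nonneg.2 ht1) (by ring)
        simp only [smul_eq_mul, Real.one_rpow, mul_one] at hc hn ⊢
        exact (Real.rpow_le_rpow (norm_nonneg _) hn hp0).trans hc
    _ = t * integralMean p (fun z => 1 - g z) r + (1 - t) := by
        rw [Real.circleAverage_fun_add hi1 hi2, Real.circleAverage_fun_smul,
          Real.circleAverage_const, smul_eq_mul, integralMean_eq_circleAverage]
    _ ≤ 1 := by nlinarith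

/-! ### Expansions for linear and constant polynomials. -/

lemma le_integralMean_one_sub_linear_mul {p δ K r : ℝ} (hT : TaylorBound p δ K) (hp : 0 ≤ p)
    (hK : 0 ≤ K) {f : ℂ → ℂ} (hf : DifferentiableOn ℂ f (Metric.ball 0 1))
    (hf1 : ∀ z ∈ Metric.ball (0 : ℂ) 1, ‖f z‖ ≤ 1) (h0 : 0 ≤ r) (h1 : r < 1)
    (hr : 1 / 2 ≤ r ^ 2 * Real.circleAverage (fun z => ‖f z‖ ^ 2) 0 r) {a w : ℂ}
    (ha : 2 * ‖a‖ ≤ δ) (hw : ‖w‖ ≤ 1) :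
    1 + (taylorPart p (a * w * f 0)).re + (p / 2) ^ 2 * (‖a‖ ^ 2 * (1 / 2 - 2 * ‖w‖))
      - K * (2 * ‖a‖) ^ 3 ≤ integralMean p (fun z => 1 - a * (z - w) * f z) r := by
  have hg : DifferentiableOn ℂ (fun z => -(a * (z - w) * f z)) (Metric.ball 0 1) := by fun_prop
  have hη : ∀ z ∈ Metric.ball (0 : ℂ) 1, ‖-(a * (z - w) * f z)‖ ≤ 2 * ‖a‖ := by
    intro z hz
    have hz1 : ‖z‖ ≤ 1 := by simpa using (Metric.ball_subset_closedBall hz)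
    have hzw : ‖z - w‖ ≤ 2 := (norm_sub_le _ _).trans (by linarith)
    rw [norm_neg, norm_mul, norm_mul]
    calc ‖a‖ * ‖z - w‖ * ‖f z‖ ≤ ‖a‖ * 2 * 1 := by gcongr; exact hf1 z hz
      _ = 2 * ‖a‖ := by ring
  have h := le_integralMean_one_add hT hp hK hg hη ha h0 h1
  have hm := mul_le_mul_of_nonneg_left (mean_sq_linear_mul_ge hf hf1 h0 h1 hr a w)
    (sq_nonneg (p / 2))
  have hg0 : -(a * (0 - w) * f 0) = a * w * f 0 := by ring
  simp only [hg0, ← sub_eq_add_neg] at h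
  linarith

lemma integralMean_one_add_const_mul_le {p δ K r : ℝ} (hT : TaylorBound p δ K) (hp : 0 ≤ p)
    (hK : 0 ≤ K) {f : ℂ → ℂ} (hf : DifferentiableOn ℂ f (Metric.ball 0 1))
    (hf1 : ∀ z ∈ Metric.ball (0 : ℂ) 1, ‖f z‖ ≤ 1) (h0 : 0 ≤ r) (h1 : r < 1) {b : ℂ}
    (hb : ‖b‖ ≤ δ) :
    integralMean p (fun z => 1 + b * f z) r ≤
      1 + (taylorPart p (b * f 0)).re + (p / 2) ^ 2 * ‖b‖ ^ 2 + K * ‖b‖ ^ 3 := by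
  refine integralMean_one_add_le (g := fun z => b * f z) hT hp hK (by fun_prop) (fun z hz => ?_)
    hb h0 h1
  rw [norm_mul]
  exact mul_le_of_le_one_right (norm_nonneg _) (hf1 z hz)

lemma abs_re_taylorPart_sub_le (p : ℝ) (z : ℂ) :
    |(taylorPart p z).re - p * z.re| ≤ |p / 2 * (p / 2 - 1)| * ‖z‖ ^ 2 := by
  rw [taylorPart, Complex.add_re, Complex.re_ofReal_mul, Complex.re_ofReal_mul,
    add_sub_cancel_left, abs_mul, ← norm_pow]
  gcongr
  exact Complex.abs_re_le_norm _

/-- The constant `t * conj (f 0)` with small `t > 0` beats `0`: its first order gain `p * t * ‖f 0‖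
^ 2` exceeds the error `D * t ^ 2 * ‖f 0‖ ^ 2`. -/
lemma IsOPA.ne_zero {n : ℕ} {p δ K : ℝ} (hp : 0 < p) (hT : TaylorBound p δ K) (hδ : 0 < δ)
    (hK : 0 ≤ K) {f : ℂ → ℂ} (hf : DifferentiableOn ℂ f (Metric.ball 0 1))
    (hf1 : ∀ z ∈ Metric.ball (0 : ℂ) 1, ‖f z‖ ≤ 1) (hf0 : f 0 ≠ 0) {q : Polynomial ℂ}
    (hq : IsOPA n p f q) : q ≠ 0 := by
  rintro rfl
  set c := |p / 2 * (p / 2 - 1)| with hc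
  have hc0 : 0 ≤ c := abs_nonneg _
  set D := c + (p / 2) ^ 2 + K with hD
  have hDpos : 0 < D := by positivity
  obtain ⟨t, ht0, ht⟩ := exists_between (lt_min (lt_min hδ one_pos) (div_pos hp hDpos))
  rw [lt_min_iff, lt_min_iff, lt_div_iff₀ hDpos] at ht
  obtain ⟨⟨htδ, ht1⟩, htD⟩ := ht
  set b : ℂ := -(t * (starRingEnd ℂ) (f 0)) with hb
  have hf0pos : 0 < ‖f 0‖ := norm_pos_iff.2 hf0
  have hf01 : ‖f 0‖ ≤ 1 := hf1 0 (by simp)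
  have hbn : ‖b‖ = t * ‖f 0‖ := by
    rw [hb, norm_neg, norm_mul, Complex.norm_of_nonneg ht0.le, RCLike.norm_conj]
  have hb1 : ‖b‖ ≤ t := by rw [hbn]; exact mul_le_of_le_one_right ht0.le hf01
  have hbf : b * f 0 = ((-(t * ‖f 0‖ ^ 2) : ℝ) : ℂ) := by
    rw [hb, neg_mul, mul_assoc, Complex.conj_mul']
    push_cast; ring
  have hup := hq.integralMean_le hp hf hf1 (s := Polynomial.C (-b))
    ((Polynomial.natDegree_C _).trans_le (Nat.zero_le _))
    (U := 1 + (taylorPart p (b * f 0)).re + (p / 2) ^ 2 * ‖b‖ ^ 2 + K * ‖b‖ ^ 3)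
    (fun r hr => by
      have := integralMean_one_add_const_mul_le hT hp.le hK hf hf1 hr.1 hr.2 (hb1.trans htδ.le)
      simpa using this) (r := 0) ⟨le_rfl, one_pos⟩
  simp only [Polynomial.eval_zero, zero_mul, sub_zero, integralMean_eq_circleAverage, norm_one,
    Real.one_rpow, Real.circleAverage_const] at hup
  have hre := (abs_le.1 (abs_re_taylorPart_sub_le p (b * f 0))).2
  rw [← hc] at hre
  have hre2 : (b * f 0).re = -(t * ‖f 0‖ ^ 2) := by rw [hbf, Complex.ofReal_re]
  have hn : ‖b * f 0‖ ^ 2 ≤ ‖b‖ ^ 2 := by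
    rw [norm_mul]
    gcongr
    exact mul_le_of_le_one_right (norm_nonneg _) hf01
  have hn3 : ‖b‖ ^ 3 ≤ ‖b‖ ^ 2 :=
    pow_le_pow_of_le_one (norm_nonneg _) (hb1.trans ht1.le) (by norm_num)
  have e1 := mul_le_mul_of_nonneg_left hn hc0
  have e2 := mul_le_mul_of_nonneg_left hn3 hK
  have e3 : p * (t * ‖f 0‖ ^ 2) ≤ D * ‖b‖ ^ 2 := by
    rw [hre2] at hre
    rw [hD]
    linarith
  rw [hbn, mul_pow] at e3
  have e4 : t * ‖f 0‖ ^ 2 * p ≤ t * ‖f 0‖ ^ 2 * (t * D) := by linarith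
  exact htD.not_ge (le_of_mul_le_mul_left e4 (by positivity))

end HardyOPA

/-! ### The two cases for the leading coefficient. -/

theorem mainTheorem2 (p : ℝ) (hp : 1 < p) :
    ∃ ρ : ℝ, 0 < ρ ∧
      ∀ f : ℂ → ℂ, HardyOPA.MemHardy p f → HardyOPA.IsInner f → f 0 ≠ 0 →
        ∀ a w : ℂ,
          HardyOPA.IsOPA 1 p f (Polynomial.C a * (Polynomial.X - Polynomial.C w)) →
            ρ ≤ ‖w‖ := by
  obtain ⟨δ, hδ, K, hK, hT⟩ := HardyOPA.norm_one_add_rpow_taylor p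
  have hp0 : 0 < p := one_pos.trans hp
  set s := (p / 2) ^ 2 with hs
  have hspos : 0 < s := by positivity
  set c := |p / 2 * (p / 2 - 1)| with hc
  have hc0 : 0 ≤ c := abs_nonneg _
  -- `d` is the threshold for `‖a‖`: `2 * d < δ` keeps the expansion valid, and `36 * K * d < s`
  -- makes the cubic errors `9 * K * d` and `8 * K * d` at most `s / 4`.
  obtain ⟨d, hd0, hd⟩ := exists_between
    (lt_min (half_pos hδ) (show 0 < s / (36 * K) by positivity))
  rw [lt_min_iff, lt_div_iff₀ (show 0 < 36 * K by positivity)] at hd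
  obtain ⟨hdδ, hdK⟩ := hd
  set D := 2 * s * d + p + c * d with hD
  have hDpos : 0 < D := by positivity
  -- `1 / 12` makes `3 * s * ‖w‖` less than `s / 4` in the small case; the other bound contradicts
  -- `s * d / 4 ≤ ‖w‖ * D` in the large case.
  refine ⟨min (1 / 12) (s * d / (4 * D)), by positivity, ?_⟩
  intro f _ hin hf0 a w hopa
  have hf := hin.1
  have hf1 : ∀ z ∈ Metric.ball (0 : ℂ) 1, ‖f z‖ ≤ 1 := fun z hz => hin.norm_le_one hz
  have hf01 : ‖f 0‖ ≤ 1 := hf1 0 (by simp)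
  obtain ⟨r, hr, hr2⟩ := hin.exists_half_le_mean_sq
  by_contra! hlt
  rw [lt_min_iff, lt_div_iff₀ (show 0 < 4 * D by positivity)] at hlt
  obtain ⟨hw, hwD⟩ := hlt
  have hw1 : ‖w‖ ≤ 1 := by linarith
  have hw0 := norm_nonneg w
  have ha : 0 < ‖a‖ := by
    rw [norm_pos_iff]
    rintro rfl
    exact hopa.ne_zero hp0 hT hδ hK.le hf hf1 hf0 (by simp)
  rcases le_total ‖a‖ d with had | had
  · have hlow := HardyOPA.le_integralMean_one_sub_linear_mul hT hp0.le hK.le hf hf1 hr.1 hr.2 hr2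
      (a := a) (by linarith) hw1
    have hb : ‖a * w‖ ≤ δ := by
      rw [norm_mul]
      nlinarith
    -- The competitor `-aw` agrees with `q` at `0`, so both sides carry the same `taylorPart` term.
    have hup := hopa.integralMean_le hp0 hf hf1 (s := Polynomial.C (-(a * w)))
      ((Polynomial.natDegree_C _).trans_le (Nat.zero_le _)) (U := _)
      (fun r hr => by
        have := HardyOPA.integralMean_one_add_const_mul_le hT hp0.le hK.le hf hf1 hr.1 hr.2 hb
        simpa only [Polynomial.eval_C, neg_mul, sub_neg_eq_add] using this) hr
    simp only [Polynomial.eval_mul, Polynomial.eval_C, Polynomial.eval_sub,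
      Polynomial.eval_X] at hup
    have h := hlow.trans hup
    rw [norm_mul, ← hs] at h
    have hw2 : ‖w‖ ^ 2 ≤ ‖w‖ := by nlinarith
    have hw3 : ‖w‖ ^ 3 ≤ 1 := pow_le_one₀ hw0 hw1
    have e1 : s * ‖a‖ ^ 2 * ‖w‖ ^ 2 ≤ s * ‖a‖ ^ 2 * ‖w‖ := by gcongr
    have e2 : K * ‖a‖ ^ 3 * ‖w‖ ^ 3 ≤ K * ‖a‖ ^ 3 * 1 := by gcongr
    have e3 : K * ‖a‖ ^ 3 ≤ K * d * ‖a‖ ^ 2 := by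
      have : K * ‖a‖ ^ 2 * ‖a‖ ≤ K * ‖a‖ ^ 2 * d := by gcongr
      linarith
    have e4 : ‖a‖ ^ 2 * (s / 2) ≤ ‖a‖ ^ 2 * (3 * s * ‖w‖ + 9 * K * d) := by linarith
    have e5 := le_of_mul_le_mul_left e4 (by positivity)
    nlinarith
  -- Shrinking by `t` brings the leading coefficient to modulus exactly `d`, within range of the
  -- expansion.
  · set t := d / ‖a‖ with ht
    have ht0 : 0 ≤ t := by positivity
    have ht1 : t ≤ 1 := (div_le_one ha).2 had
    have hta : ‖(t : ℂ) * a‖ = d := by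
      rw [norm_mul, Complex.norm_of_nonneg ht0, ht, div_mul_cancel₀ _ ha.ne']
    have hlow := HardyOPA.le_integralMean_one_sub_linear_mul hT hp0.le hK.le hf hf1 hr.1 hr.2 hr2
      (a := t * a) (w := w) (by linarith) hw1
    have hup := hopa.integralMean_le_one hp0 hf hf1 hr
    simp only [Polynomial.eval_mul, Polynomial.eval_C, Polynomial.eval_sub,
      Polynomial.eval_X] at hup
    have hup' := HardyOPA.integralMean_one_sub_smul_le (t := t) hp.le
      (g := fun z => a * (z - w) * f z)
      (by have := hf.continuousOn; fun_prop) hr.1 hr.2 ht0 ht1 hup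
    simp only [← mul_assoc] at hup'
    have h := hlow.trans hup'
    have hre := (abs_le.1 (HardyOPA.abs_re_taylorPart_sub_le p (t * a * w * f 0))).1
    have hn : ‖t * a * w * f 0‖ ≤ d * ‖w‖ := by
      rw [norm_mul, norm_mul, hta]
      exact mul_le_of_le_one_right (by positivity) hf01
    have hre2 := (abs_le.1 ((Complex.abs_re_le_norm _).trans hn)).1
    rw [hta, ← hs] at h
    rw [← hc] at hre
    have e1 : c * ‖t * a * w * f 0‖ ^ 2 ≤ c * (d * ‖w‖) ^ 2 := by gcongr
    have hw2 : ‖w‖ ^ 2 ≤ ‖w‖ := by nlinarith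
    have e2 : c * d ^ 2 * ‖w‖ ^ 2 ≤ c * d ^ 2 * ‖w‖ := by gcongr
    have e3 := mul_le_mul_of_nonneg_left hre2 hp0.le
    have e4 : d ^ 2 * (36 * K * d) ≤ d ^ 2 * s := by gcongr; linarith
    -- The three terms of `D` come from the loss `2 * ‖w‖` in the mean square and from the linear
    -- and quadratic parts of `taylorPart`.
    have e5 : d * (s * d / 4) ≤ d * (‖w‖ * D) := by
      have : 0 ≤ d ^ 2 * s := by positivity
      rw [hD]
      linarith
    have e6 := le_of_mul_le_mul_left e5 hd0
    linarith
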